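/- Let $S$ be a semigroup and let $S^1$ be $S$ with an identity element adjoined if necessary. An element $b\in S$ is called regular if $b=bxb$ for some $x\in S$, and cyclic if $b=axa$ for some $a\in S$ and $x\in S^{1}$. A semigroup is called cyclically regular if each of its cyclic elements is regular. A variety of semigroups is the class of all semigroups that satisfy a given set (possibly infinite) of semigroup identities $u=v$, where $u,v$ are nonempty words over a countably infinite alphabet. Let $V$ be a variety of semigroups. If every finite semigroup in $V$ is cyclically regular, then every semigroup in $V$ is cyclically regular. -/

import Mathlib

/-- An element `b` of a semigroup is regular (in the sense of von Neumann) if `b = b x b` for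
some `x` in the semigroup. -/
def IsRegularElement {S : Type*} [Semigroup S] (b : S) : Prop :=
  ∃ x : S, b = b * x * b

/-- An element `b` of a semigroup `S` is cyclic if `b = a x a` for some `a ∈ S` and `x ∈ S¹`.
The first alternative is the case where `x` is the identity of `S¹`. -/
def IsCyclicElement {S : Type*} [Semigroup S] (b : S) : Prop :=
  ∃ a : S, b = a * a ∨ ∃ x : S, b = a * x * a

/-- A semigroup is cyclically regular if each of its cyclic elements is regular. -/
def IsCyclicallyRegular (S : Type*) [Semigroup S] : Prop :=
  ∀ b : S, IsCyclicElement b → IsRegularElement b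

/-- A semigroup identity `u = v`: a pair of (nonempty) words over a countable alphabet. -/
abbrev SemigroupIdentity : Type :=
  FreeSemigroup ℕ × FreeSemigroup ℕ

/-- The identity `u = v` holds in `S` if `u` and `v` take equal values under every substitution
of elements of `S` for the letters. -/
def SatisfiesIdentity (S : Type*) [Semigroup S] (p : SemigroupIdentity) : Prop :=
  ∀ f : ℕ → S, FreeSemigroup.lift f p.1 = FreeSemigroup.lift f p.2

/-- `S` belongs to the variety of semigroups defined by the set `E` of identities if all the
identities in `E` hold in `S`. -/
def MemVariety (E : Set SemigroupIdentity) (S : Type*) [Semigroup S] : Prop :=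
  ∀ p ∈ E, SatisfiesIdentity S p

/-! The tool is `exists_regular_preimage`: if an ideal of a semigroup mapping to `S` has an image
that misses the cyclic element and leaves only finitely many values outside, then the Rees quotient
of the image is a finite member of the variety, and regularity there lifts to `S`. Applied to words
in one letter, it makes every element periodic from the square on, which settles `a * a`.

For `a * x * a` there are two cases. If the Brandt semigroup is in the variety, a second coordinate
in it forces any word with the value of `a * x * a` to alternate. Either such a word is long, and
regularity can be read off, or the words of length at least 4 form a suitable ideal.

Otherwise an identity failing in the Brandt semigroup makes a power of `a * c` divisible by `a * a`.
Then `a * x * a` is regular once it is divisible by some `g = g ^ k` with `k ≥ 2` such that `a * x`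
divides `g * g` (`isRegularElement_of_eq_mul_mul`). Long words in `a` and `x` contain such a `g` or
a shortenable power of a letter. So if `a * x * a` were not regular, its divisors among these words
would have finitely many values (`exists_shorter`), and the tool would apply to the ideal of
non-divisors. -/

namespace SemigroupIdentity

/-! ### Words and their values -/

/-- The list of letters of a nonempty word. -/
def letters {α : Type*} (w : FreeSemigroup α) : List α := w.head :: w.tail

@[simp] lemma letters_of {α : Type*} (t : α) : letters (FreeSemigroup.of t) = [t] := rfl

@[simp] lemma letters_mul {α : Type*} (v w : FreeSemigroup α) :
    letters (v * w) = letters v ++ letters w := rfl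

lemma letters_injective {α : Type*} : Function.Injective (letters (α := α)) := by
  intro v w h
  simp only [letters, List.cons.injEq] at h
  exact FreeSemigroup.ext h.1 h.2

lemma exists_letters_eq {α : Type*} {l : List α} (hl : l ≠ []) :
    ∃ w : FreeSemigroup α, letters w = l := by
  cases l with
  | nil => exact absurd rfl hl
  | cons t l => exact ⟨⟨t, l⟩, rfl⟩

lemma coe_lift {α S : Type*} [Semigroup S] (f : α → S) (w : FreeSemigroup α) :
    ((FreeSemigroup.lift f w : S) : WithOne S) =
      ((letters w).map fun t => (f t : WithOne S)).prod := by
  induction w with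
  | ih1 t => simp
  | ih2 v w hv hw => simp only [map_mul, WithOne.coe_mul, hv, hw, letters_mul, List.map_append,
      List.prod_append]

lemma map_lift {α S T : Type*} [Semigroup S] [Semigroup T] (g : S →ₙ* T) (f : α → S)
    (w : FreeSemigroup α) :
    g (FreeSemigroup.lift f w) = FreeSemigroup.lift (fun t => g (f t)) w := by
  have h : g.comp (FreeSemigroup.lift f) = FreeSemigroup.lift (fun t => g (f t)) :=
    FreeSemigroup.hom_ext rfl
  exact DFunLike.congr_fun h w

/-! ### Closure properties of varieties -/

lemma memVariety_of_injective {E : Set SemigroupIdentity} {S T : Type*} [Semigroup S]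
    [Semigroup T] (g : T →ₙ* S) (hg : Function.Injective g) (hS : MemVariety E S) :
    MemVariety E T := fun p hp f => hg <| by
  rw [map_lift, map_lift]
  exact hS p hp _

lemma memVariety_prod {E : Set SemigroupIdentity} {S T : Type*} [Semigroup S]
    [Semigroup T] (hS : MemVariety E S) (hT : MemVariety E T) : MemVariety E (S × T) := by
  intro p hp f
  refine Prod.ext ?_ ?_
  · have := hS p hp (fun n => (f n).1)
    exact (map_lift (MulHom.fst S T) f _).trans (this.trans (map_lift (MulHom.fst S T) f _).symm)
  · have := hT p hp (fun n => (f n).2)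
    exact (map_lift (MulHom.snd S T) f _).trans (this.trans (map_lift (MulHom.snd S T) f _).symm)

/-- Every finite semigroup (in the lowest universe) in the variety is cyclically regular. -/
def FinitelyCyclicallyRegular (E : Set SemigroupIdentity) : Prop :=
  ∀ (F : Type) [Semigroup F] [Finite F], MemVariety E F → IsCyclicallyRegular F

universe u

/-- The finite semigroups needed are quotients of free semigroups on at most two letters, so they
live in `Type`; `ULift` carries them to the universe of the hypothesis. -/
lemma finitelyCyclicallyRegular_of_universe {E : Set SemigroupIdentity}
    (h : ∀ (F : Type u) [Semigroup F] [Finite F], MemVariety E F → IsCyclicallyRegular F) :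
    FinitelyCyclicallyRegular E := by
  intro F _ _ hF b hb
  have hU : MemVariety E (ULift.{u} F) :=
    memVariety_of_injective (MulEquiv.ulift : ULift.{u} F ≃* F).toMulHom
      (MulEquiv.ulift : ULift.{u} F ≃* F).injective hF
  have hb' : IsCyclicElement (ULift.up.{u} b) := by
    obtain ⟨a, rfl | ⟨x, rfl⟩⟩ := hb
    · exact ⟨⟨a⟩, Or.inl rfl⟩
    · exact ⟨⟨a⟩, Or.inr ⟨⟨x⟩, rfl⟩⟩
  obtain ⟨x, hx⟩ := h _ hU _ hb'
  exact ⟨x.down, congrArg ULift.down hx⟩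

/-! ### Finite Rees quotients -/

/-- The congruence that collapses the saturation of an ideal `J` along `φ`, and is the kernel of
`φ` elsewhere. -/
def reesCon {W S : Type*} [Semigroup W] [Semigroup S] (φ : W →ₙ* S) (J : Set W)
    (hJ : ∀ w ∈ J, ∀ v, w * v ∈ J ∧ v * w ∈ J) : Con W where
  r v w := φ v = φ w ∨ (φ v ∈ φ '' J ∧ φ w ∈ φ '' J)
  iseqv := by
    refine ⟨fun _ => Or.inl rfl, fun h => ?_, fun h₁ h₂ => ?_⟩
    · exact h.imp Eq.symm And.symm
    · rcases h₁ with h₁ | ⟨h₁, h₁'⟩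
      · rw [h₁]; exact h₂
      · rcases h₂ with h₂ | ⟨h₂, h₂'⟩
        · exact Or.inr ⟨h₁, h₂ ▸ h₁'⟩
        · exact Or.inr ⟨h₁, h₂'⟩
  mul' := by
    have key : ∀ w v : W, φ w ∈ φ '' J → φ (w * v) ∈ φ '' J ∧ φ (v * w) ∈ φ '' J := by
      rintro w v ⟨j, hj, hjw⟩
      exact ⟨⟨j * v, (hJ j hj v).1, by simp [hjw]⟩, ⟨v * j, (hJ j hj v).2, by simp [hjw]⟩⟩
    intro w x y z h₁ h₂
    rcases h₁ with h₁ | ⟨h₁, h₁'⟩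
    · rcases h₂ with h₂ | ⟨h₂, h₂'⟩
      · left; simp [h₁, h₂]
      · exact Or.inr ⟨(key _ _ h₂).2, (key _ _ h₂').2⟩
    · exact Or.inr ⟨(key _ _ h₁).1, (key _ _ h₁').1⟩

lemma exists_regular_preimage {E : Set SemigroupIdentity} (hE : FinitelyCyclicallyRegular E)
    {S : Type*} [Semigroup S] (hS : MemVariety E S) {W : Type} [Semigroup W] (φ : W →ₙ* S)
    (J : Set W) (hJ : ∀ w ∈ J, ∀ v, w * v ∈ J ∧ v * w ∈ J) (hfin : (φ '' Jᶜ).Finite)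
    {b : W} (hb : IsCyclicElement b) (hbJ : ∀ w ∈ J, φ w ≠ φ b) :
    ∃ y, φ b = φ (b * y * b) := by
  classical
  let c := reesCon φ J hJ
  have hV : MemVariety E c.Quotient := by
    intro p hp f
    choose g hg using fun n => Quotient.exists_rep (f n)
    let π : W →ₙ* c.Quotient := ⟨fun w => (w : c.Quotient), fun _ _ => rfl⟩
    have hf : f = fun n => π (g n) := funext fun n => (hg n).symm
    rw [hf, ← map_lift π, ← map_lift π]
    refine (Con.eq c).2 (Or.inl ?_)
    rw [map_lift, map_lift]
    exact hS p hp _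
  have : Finite c.Quotient := by
    have : Finite (φ '' Jᶜ) := hfin
    -- The collapsed class goes to `none`; every other class is determined by its value in `S`.
    let F : c.Quotient → Option (φ '' Jᶜ) := fun q =>
      if h : φ q.out ∈ φ '' J then none
      else some ⟨φ q.out, q.out, fun hJ' => h ⟨_, hJ', rfl⟩, rfl⟩
    refine Finite.of_injective F fun q q' hqq => ?_
    rw [← Quotient.out_eq q, ← Quotient.out_eq q']
    refine Quotient.sound (?_ : φ _ = φ _ ∨ _)
    by_cases h : φ q.out ∈ φ '' J <;> by_cases h' : φ q'.out ∈ φ '' J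
    · exact Or.inr ⟨h, h'⟩
    · simp only [F, dif_pos h, dif_neg h', reduceCtorEq] at hqq
    · simp only [F, dif_neg h, dif_pos h', reduceCtorEq] at hqq
    · simp only [F, dif_neg h, dif_neg h', Option.some.injEq] at hqq
      exact Or.inl (congrArg Subtype.val hqq)
  have hb' : IsCyclicElement (b : c.Quotient) := by
    obtain ⟨a, rfl | ⟨x, rfl⟩⟩ := hb
    · exact ⟨a, Or.inl rfl⟩
    · exact ⟨a, Or.inr ⟨x, rfl⟩⟩
  obtain ⟨y, hy⟩ := hE _ hV _ hb'
  induction y using Con.induction_on with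
  | _ y =>
    have h : c b (b * y * b) := (Con.eq c).1 hy
    rcases h with h | ⟨⟨w, hw, hwb⟩, -⟩
    · exact ⟨y, h⟩
    · exact absurd hwb (hbJ w hw)

/-! ### Divisibility in a semigroup with an adjoined identity -/

lemma isRegularElement_of_coe {S : Type*} [Semigroup S] {b : S} {z : WithOne S}
    (h : (b : WithOne S) = b * z * b) : IsRegularElement b := by
  induction z using WithOne.recOneCoe with
  | one =>
    have h' : b = b * b := by exact_mod_cast (by simpa using h : (b : WithOne S) = b * b)
    exact ⟨b, by rw [← h', ← h']⟩
  | coe z => exact ⟨z, by exact_mod_cast h⟩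

lemma exists_coe_eq_mul {S : Type*} [Semigroup S] (p q : WithOne S) (s : S) :
    ∃ t : S, (t : WithOne S) = p * s * q := by
  induction p using WithOne.recOneCoe with
  | one =>
    induction q using WithOne.recOneCoe with
    | one => exact ⟨s, by simp⟩
    | coe q => exact ⟨s * q, by simp⟩
  | coe p =>
    induction q using WithOne.recOneCoe with
    | one => exact ⟨p * s, by simp⟩
    | coe q => exact ⟨p * s * q, by simp⟩

lemma exists_coe_eq_pow {S : Type*} [Semigroup S] (s : S) {n : ℕ} (hn : 1 ≤ n) :
    ∃ t : S, (t : WithOne S) = (s : WithOne S) ^ n := by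
  obtain ⟨k, rfl⟩ := Nat.exists_eq_add_of_le hn
  obtain ⟨t, ht⟩ := exists_coe_eq_mul 1 ((s : WithOne S) ^ k) s
  exact ⟨t, by rw [ht, pow_add]; simp⟩

/-! ### Monogenic and local subsemigroups -/

/-- If `s ^ 2` equals no higher power, collapsing the powers from the cube on leaves a finite
quotient; regularity of `s ^ 2` there equates it with a higher power after all. -/
lemma exists_sq_eq_pow {E : Set SemigroupIdentity} (hE : FinitelyCyclicallyRegular E)
    {S : Type*} [Semigroup S] (hS : MemVariety E S) (s : S) :
    ∃ d, 1 ≤ d ∧ (s : WithOne S) ^ 2 = (s : WithOne S) ^ (2 + d) := by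
  by_contra! hne
  let φ : FreeSemigroup Unit →ₙ* S := FreeSemigroup.lift fun _ => s
  have hφ : ∀ w, (φ w : WithOne S) = (s : WithOne S) ^ w.length := fun w => by
    rw [coe_lift]; simp [letters, FreeSemigroup.length, pow_succ']
  let t := FreeSemigroup.of ()
  obtain ⟨y, hy⟩ := exists_regular_preimage hE hS φ {w | 3 ≤ w.length}
    (fun w hw v => by
      simp only [Set.mem_ofPred_eq, FreeSemigroup.length_mul] at *
      omega)
    (by
      refine (Set.toFinite {φ t, φ (t * t)}).subset ?_
      rintro _ ⟨w, hw, rfl⟩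
      simp only [Set.mem_compl_iff, Set.mem_ofPred_eq, not_le] at hw
      have h0 : 1 ≤ w.length := by simp [FreeSemigroup.length]
      obtain h | h : w.length = 1 ∨ w.length = 2 := by omega
      · left; apply WithOne.coe_injective; rw [hφ, hφ, h]; rfl
      · right; apply WithOne.coe_injective; rw [hφ, hφ, h]; rfl)
    (b := t * t) ⟨t, Or.inl rfl⟩
    (fun w hw h => by
      have h' := congrArg (WithOne.coe) h
      rw [hφ, hφ] at h'
      obtain ⟨d, hd⟩ := Nat.exists_eq_add_of_le (show 3 ≤ w.length from hw)
      refine hne (d + 1) (by omega) ?_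
      rw [show 2 + (d + 1) = w.length by omega, h']
      rfl)
  have h' := congrArg (WithOne.coe) hy
  rw [hφ, hφ] at h'
  refine hne (y.length + 2) (by omega) ?_
  have ht : t.length = 1 := rfl
  rw [show 2 + (y.length + 2) = (t * t * y * (t * t)).length by
    simp only [FreeSemigroup.length_mul, ht]; omega, ← h']
  rfl

/-- Since `z = e * z * e` is cyclic, the same argument works in the subsemigroup generated by `e`
and `z`, graded by the number of occurrences of `z`. -/
lemma exists_eq_pow_of_idempotent {E : Set SemigroupIdentity}
    (hE : FinitelyCyclicallyRegular E) {S : Type*} [Semigroup S] (hS : MemVariety E S)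
    {e z : S} (he : e * e = e) (hez : e * z = z) (hze : z * e = z) :
    ∃ k, 2 ≤ k ∧ (z : WithOne S) = (z : WithOne S) ^ k := by
  by_contra! hne
  let φ : FreeSemigroup Bool →ₙ* S := FreeSemigroup.lift fun t => if t then z else e
  let n : FreeSemigroup Bool → ℕ := fun w => (letters w).count true
  have hn : ∀ v w, n (v * w) = n v + n w := fun v w => by simp [n]
  have he' : (e : WithOne S) * e = e := by exact_mod_cast he
  have hez' : (e : WithOne S) * z = z := by exact_mod_cast hez
  have hze' : (z : WithOne S) * e = z := by exact_mod_cast hze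
  have hezn : ∀ k, (e : WithOne S) * (z ^ k * e) = (z : WithOne S) ^ k * e := fun k => by
    cases k with
    | zero => simp [he']
    | succ k => rw [pow_succ', mul_assoc, ← mul_assoc, hez']
  have hφ : ∀ w, (φ w : WithOne S) = (z : WithOne S) ^ n w * e := fun w => by
    induction w with
    | ih1 t => cases t <;> simp [φ, n, hze']
    | ih2 t w ht hw =>
      rw [map_mul, WithOne.coe_mul, ht, hw, hn, mul_assoc, hezn, pow_add, mul_assoc]
  have hpow : ∀ k, 1 ≤ k → (z : WithOne S) ^ k * e = (z : WithOne S) ^ k := fun k hk => by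
    obtain ⟨j, rfl⟩ := Nat.exists_eq_add_of_le' hk
    rw [pow_succ, mul_assoc, hze']
  let te := FreeSemigroup.of false
  let tz := FreeSemigroup.of true
  have hb1 : n (te * tz * te) = 1 := by simp [hn, te, tz]; simp [n]
  obtain ⟨y, hy⟩ := exists_regular_preimage hE hS φ {w | 2 ≤ n w}
    (fun w hw v => by
      simp only [Set.mem_ofPred_eq, hn] at *
      omega)
    (by
      refine (Set.toFinite {e, z}).subset ?_
      rintro _ ⟨w, hw, rfl⟩
      simp only [Set.mem_compl_iff, Set.mem_ofPred_eq, not_le] at hw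
      obtain h | h : n w = 0 ∨ n w = 1 := by omega
      · left; apply WithOne.coe_injective; rw [hφ, h]; simp
      · right; apply WithOne.coe_injective; rw [hφ, h]; simp [hze'])
    (b := te * tz * te) ⟨te, Or.inr ⟨tz, rfl⟩⟩
    (fun w hw h => by
      have h' := congrArg (WithOne.coe) h
      have hw' : 2 ≤ n w := hw
      rw [hφ, hφ, hb1, hpow _ (by omega), hpow _ le_rfl, pow_one] at h'
      exact hne _ hw' h'.symm)
  have h' := congrArg (WithOne.coe) hy
  rw [hφ, hφ, hn (_ * y), hn _ y, hb1, hpow _ (by omega), hpow _ (by omega), pow_one] at h'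
  exact hne _ (by omega) h'

universe v

/-! ### The five-element Brandt semigroup -/

/-- The five-element combinatorial Brandt semigroup: the `2 × 2` matrix units and zero. -/
inductive Brandt : Type
  | zero : Brandt
  | unit (i j : Bool) : Brandt

namespace Brandt

/-- Multiplication of matrix units. -/
def mul : Brandt → Brandt → Brandt
  | unit i j, unit k l => if j = k then unit i l else zero
  | _, _ => zero

instance : Semigroup Brandt where
  mul := mul
  mul_assoc := by
    rintro (_ | ⟨_ | _, _ | _⟩) (_ | ⟨_ | _, _ | _⟩) (_ | ⟨_ | _, _ | _⟩) <;> rfl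

lemma unit_mul_unit (i j k l : Bool) :
    unit i j * unit k l = if j = k then unit i l else zero := rfl

lemma mul_zero (t : Brandt) : t * zero = zero := by cases t <;> rfl

instance : Finite Brandt :=
  Finite.of_surjective (fun t : Option (Bool × Bool) => t.elim zero fun p => unit p.1 p.2)
    (by rintro (_ | ⟨i, j⟩); exacts [⟨none, rfl⟩, ⟨some (i, j), rfl⟩])

/-- The two generators of the Brandt semigroup. -/
def gen (t : Bool) : Brandt := unit (!t) t

/-- A word in the generators representing a given element. -/
def word : Brandt → FreeSemigroup Bool
  | zero => .of true * .of true
  | unit false true => .of true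
  | unit true false => .of false
  | unit false false => .of true * .of false
  | unit true true => .of false * .of true

lemma lift_gen_word (t : Brandt) : FreeSemigroup.lift gen t.word = t := by
  rcases t with _ | ⟨_ | _, _ | _⟩ <;> rfl

/-- A word that does not vanish in the Brandt semigroup is alternating. -/
lemma prod_eq_of_prod_gen_eq {M : Type*} [Monoid M] (g : Bool → M) (l : List Bool) {i j : Bool}
    (h : (l.map fun t => (gen t : WithOne Brandt)).prod = (unit i j : Brandt)) :
    ∃ m, (l.map g).prod =
        (if i then g false else 1) * (g true * g false) ^ m * (if j then g true else 1) ∧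
      l.length = 2 * m + i.toNat + j.toNat := by
  induction l generalizing i with
  | nil => simp at h
  | cons t l ih =>
    rw [List.map_cons, List.prod_cons] at h
    generalize hP : (l.map fun t => (gen t : WithOne Brandt)).prod = P at h
    induction P using WithOne.recOneCoe with
    | one =>
      have hl : l = [] := by
        cases l with
        | nil => rfl
        | cons s l =>
          obtain ⟨t, ht⟩ := exists_coe_eq_mul 1
            (l.map fun t => (gen t : WithOne Brandt)).prod (gen s)
          rw [one_mul] at ht
          rw [List.map_cons, List.prod_cons, ← ht] at hP
          exact absurd hP WithOne.coe_ne_one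
      subst hl
      rw [mul_one, WithOne.coe_inj, gen, unit.injEq] at h
      obtain ⟨rfl, rfl⟩ := h
      refine ⟨0, ?_⟩
      cases t <;> simp
    | coe s =>
      rw [← WithOne.coe_mul, WithOne.coe_inj] at h
      rcases s with _ | ⟨k, n⟩
      · rw [mul_zero] at h; cases h
      · rw [gen, unit_mul_unit] at h
        split_ifs at h with htk
        subst htk
        rw [unit.injEq] at h
        obtain ⟨rfl, rfl⟩ := h
        obtain ⟨m, hm, hlen⟩ := ih hP
        cases t
        · refine ⟨m, ?_, ?_⟩
          · rw [List.map_cons, List.prod_cons, hm]; simp [mul_assoc]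
          · simp only [List.length_cons, hlen]; simp; omega
        · refine ⟨m + 1, ?_, ?_⟩
          · rw [List.map_cons, List.prod_cons, hm, pow_succ']; simp [mul_assoc]
          · simp only [List.length_cons, hlen]; simp; omega

lemma exists_square_of_prod_gen_eq_zero (l : List Bool)
    (h : (l.map fun t => (gen t : WithOne Brandt)).prod = (zero : Brandt)) :
    ∃ t l₁ l₂, l = l₁ ++ [t, t] ++ l₂ := by
  induction l with
  | nil => simp at h
  | cons t l ih =>
    rw [List.map_cons, List.prod_cons] at h
    cases l with
    | nil => simp [gen] at h
    | cons s l =>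
      by_cases hst : s = t
      · exact ⟨t, [], l, by simp [hst]⟩
      · obtain ⟨r, l₁, l₂, hl⟩ := ih <| by
          rw [List.map_cons, List.prod_cons] at h ⊢
          generalize (l.map fun t => (gen t : WithOne Brandt)).prod = P at h ⊢
          induction P using WithOne.recOneCoe with
          | one =>
            rw [mul_one, ← WithOne.coe_mul, WithOne.coe_inj, gen, gen, unit_mul_unit] at h
            cases s <;> cases t <;> simp at hst h
          | coe P =>
            rw [← WithOne.coe_mul, ← WithOne.coe_mul, WithOne.coe_inj] at h
            rw [← WithOne.coe_mul, WithOne.coe_inj]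
            rcases P with _ | ⟨_ | _, _ | _⟩ <;> cases s <;> cases t <;>
              first | rfl | exact absurd rfl hst | cases h
        exact ⟨r, t :: l₁, l₂, by simp [hl]⟩

end Brandt

/-- In a variety not containing the Brandt semigroup, some power of `a * c` is divisible by the
square of `a`. -/
lemma exists_pow_eq_mul_sq_mul {E : Set SemigroupIdentity} (hB : ¬ MemVariety E Brandt) :
    ∃ m, ∀ (S : Type v) [Semigroup S], MemVariety E S → ∀ a c : S, ∃ p q : WithOne S,
      ((a : WithOne S) * c) ^ m = p * (a * a) * q := by
  have hUV : ∃ U V : FreeSemigroup Bool, (∃ i j, FreeSemigroup.lift Brandt.gen U = .unit i j) ∧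
      FreeSemigroup.lift Brandt.gen V ≠ FreeSemigroup.lift Brandt.gen U ∧
      ∀ (S : Type v) [Semigroup S], MemVariety E S → ∀ f : Bool → S,
        FreeSemigroup.lift f U = FreeSemigroup.lift f V := by
    simp only [MemVariety, SatisfiesIdentity, not_forall] at hB
    obtain ⟨p, hp, f, hf⟩ := hB
    -- Replacing the elements of the failing substitution by words in the generators yields a
    -- two-letter identity that already fails at the generators.
    let g : ℕ → FreeSemigroup Bool := fun n => (f n).word
    have hg : ∀ w, FreeSemigroup.lift Brandt.gen (FreeSemigroup.lift g w) =
        FreeSemigroup.lift f w := fun w => by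
      rw [map_lift]; simp only [g, Brandt.lift_gen_word]
    have hid : ∀ (S : Type v) [Semigroup S], MemVariety E S → ∀ f : Bool → S,
        FreeSemigroup.lift f (FreeSemigroup.lift g p.1) =
          FreeSemigroup.lift f (FreeSemigroup.lift g p.2) := fun S _ hS f => by
      rw [map_lift, map_lift]; exact hS p hp _
    rcases h : FreeSemigroup.lift f p.1 with _ | ⟨i, j⟩
    · rcases h' : FreeSemigroup.lift f p.2 with _ | ⟨i, j⟩
      · exact absurd (h.trans h'.symm) hf
      · refine ⟨_, _, ⟨i, j, (hg p.2).trans h'⟩, ?_, fun S _ hS f => (hid S hS f).symm⟩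
        rwa [hg, hg]
    · refine ⟨_, _, ⟨i, j, (hg p.1).trans h⟩, ?_, hid⟩
      rw [hg, hg]; exact Ne.symm hf
  obtain ⟨U, V, ⟨i, j, hU⟩, hVU, hid⟩ := hUV
  -- Padding moves the nonzero side to an idempotent, so its word becomes a power of one alternating
  -- pair; the other side becomes zero and so contains a repeated letter.
  let P : FreeSemigroup Bool := Brandt.word (.unit false i)
  let Q : FreeSemigroup Bool := Brandt.word (.unit j false)
  have hU' : FreeSemigroup.lift Brandt.gen (P * U * Q) = .unit false false := by
    simp [P, Q, Brandt.lift_gen_word, hU, Brandt.unit_mul_unit]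
  have hV' : FreeSemigroup.lift Brandt.gen (P * V * Q) = .zero := by
    simp only [P, Q, Brandt.lift_gen_word, map_mul]
    rw [hU] at hVU
    rcases h : FreeSemigroup.lift Brandt.gen V with _ | ⟨k, l⟩
    · rfl
    · rw [h] at hVU
      rw [Brandt.unit_mul_unit]
      split_ifs with hik
      · rw [Brandt.unit_mul_unit]
        split_ifs with hlj
        · exact absurd (by rw [hik, hlj]) hVU
        · rfl
      · rfl
  have hid' : ∀ (S : Type v) [Semigroup S], MemVariety E S → ∀ f : Bool → S,
      FreeSemigroup.lift f (P * U * Q) = FreeSemigroup.lift f (P * V * Q) := fun S _ hS f => by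
    simp only [map_mul, hid S hS f]
  obtain ⟨t, l₁, l₂, hl⟩ := Brandt.exists_square_of_prod_gen_eq_zero (letters (P * V * Q))
    (by rw [← coe_lift, hV'])
  -- The exponent is read off the length of the word, hence is the same for all `S`.
  obtain ⟨m, hm⟩ : ∃ m, (letters (P * U * Q)).length = 2 * m := by
    obtain ⟨m, -, hm⟩ := Brandt.prod_eq_of_prod_gen_eq (fun _ => 1) (M := ℕ)
      (letters (P * U * Q)) (i := false) (j := false) (by rw [← coe_lift, hU'])
    exact ⟨m, by simpa using hm⟩
  have hsq : ∀ (S : Type v) [Semigroup S], MemVariety E S → ∀ f : Bool → S,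
      ∃ p q : WithOne S, ((f true : WithOne S) * f false) ^ m = p * (f t * f t) * q := by
    intro S _ hS f
    obtain ⟨n, hn, hn'⟩ := Brandt.prod_eq_of_prod_gen_eq (fun t => (f t : WithOne S))
      (letters (P * U * Q)) (i := false) (j := false) (by rw [← coe_lift, hU'])
    simp only [Bool.false_eq_true, if_false, one_mul, mul_one, Bool.toNat_false, add_zero]
      at hn hn'
    obtain rfl : n = m := by omega
    rw [← coe_lift, hid' S hS f, coe_lift, hl] at hn
    refine ⟨(l₁.map fun t => (f t : WithOne S)).prod, (l₂.map fun t => (f t : WithOne S)).prod,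
      hn.symm.trans ?_⟩
    simp only [List.map_append, List.prod_append]
    simp
  cases t with
  | true =>
    refine ⟨m, fun S _ hS a c => ?_⟩
    simpa using hsq S hS (fun t => if t then a else c)
  | false =>
    -- The repeated letter is the second one, so the roles of `a` and `c` are swapped; `(a * c) ^ (m
    -- + 1)` contains `(c * a) ^ m`.
    refine ⟨m + 1, fun S _ hS a c => ?_⟩
    obtain ⟨p, q, hpq⟩ := hsq S hS (fun t => if t then c else a)
    simp only [if_true, Bool.false_eq_true, if_false] at hpq
    refine ⟨a * p, q * c, ?_⟩
    have h : ∀ n, ((a : WithOne S) * c) ^ (n + 1) = a * (c * a) ^ n * c := fun n => by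
      induction n with
      | zero => simp
      | succ n ih => rw [pow_succ, ih, pow_succ]; simp only [mul_assoc]
    rw [h, hpq]; simp only [mul_assoc]

/-! ### Varieties containing the Brandt semigroup -/

lemma isRegularElement_of_brandt_mem {E : Set SemigroupIdentity}
    (hE : FinitelyCyclicallyRegular E) (hB : MemVariety E Brandt)
    {S : Type*} [Semigroup S] (hS : MemVariety E S) (a x : S) :
    IsRegularElement (a * x * a) := by
  let φ : FreeSemigroup Bool →ₙ* S × Brandt :=
    FreeSemigroup.lift fun t => (if t then a else x, Brandt.gen t)
  have hφ₁ : ∀ w, (φ w).1 = FreeSemigroup.lift (fun t => if t then a else x) w := fun w =>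
    map_lift (MulHom.fst S Brandt) _ w
  have hφ₂ : ∀ w, (φ w).2 = FreeSemigroup.lift Brandt.gen w := fun w =>
    map_lift (MulHom.snd S Brandt) _ w
  let ta := FreeSemigroup.of true
  let tx := FreeSemigroup.of false
  have hφb : (φ (ta * tx * ta)).1 = a * x * a := hφ₁ _
  by_cases hne : ∃ w : FreeSemigroup Bool, 4 ≤ (letters w).length ∧ φ w = φ (ta * tx * ta)
  · obtain ⟨w, hw, hwφ⟩ := hne
    have h₁ := hφ₁ w
    have h₂ := hφ₂ w
    rw [hwφ] at h₁ h₂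
    obtain ⟨m, hm, hlen⟩ := Brandt.prod_eq_of_prod_gen_eq
      (fun t => ((if t then a else x : S) : WithOne S)) (letters w) (i := false) (j := true)
      (by rw [← coe_lift, ← h₂]; rfl)
    rw [← coe_lift, ← h₁, hφb] at hm
    have hm2 : 2 ≤ m := by simp at hlen; omega
    have hb : (a : WithOne S) * x * a = ((a : WithOne S) * x) ^ m * a := by simpa using hm
    obtain ⟨j, rfl⟩ := Nat.exists_eq_add_of_le' hm2
    -- For `j = 0` the word is too short to contain two disjoint copies of `a * x * a`; substituting
    -- the equation into itself makes it long enough.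
    have hb' : (a : WithOne S) * x * a = ((a : WithOne S) * x) ^ (2 * j + 3) * a := by
      calc (a : WithOne S) * x * a = ((a : WithOne S) * x) ^ (j + 2) * a := hb
        _ = ((a : WithOne S) * x) ^ (j + 1) * (a * x * a) := by
          rw [pow_succ]; simp only [mul_assoc]
        _ = ((a : WithOne S) * x) ^ (j + 1) * (((a : WithOne S) * x) ^ (j + 2) * a) := by
          rw [← hb]
        _ = _ := by rw [← mul_assoc, ← pow_add]; congr 2; omega
    refine isRegularElement_of_coe (z := x * (a * x) ^ (2 * j)) ?_
    push_cast
    calc (a : WithOne S) * x * a = ((a : WithOne S) * x) ^ (2 + 2 * j + 1) * a := by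
          rw [hb']; congr 2; omega
      _ = _ := by rw [pow_succ, pow_add, sq]; simp only [mul_assoc]
  · push Not at hne
    obtain ⟨y, hy⟩ := exists_regular_preimage hE (memVariety_prod hS hB) φ
      {w | 4 ≤ (letters w).length}
      (fun w hw v => by
        simp only [Set.mem_ofPred_eq, letters_mul, List.length_append] at *
        omega)
      (by
        refine Set.Finite.image _ ?_
        refine Set.Finite.of_finite_image ((List.finite_length_lt Bool 4).subset ?_)
          (f := letters) letters_injective.injOn
        rintro _ ⟨w, hw, rfl⟩
        simpa using hw)
      (b := ta * tx * ta) ⟨ta, Or.inr ⟨tx, rfl⟩⟩ (fun w hw => hne w hw)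
    refine ⟨(φ y).1, ?_⟩
    have h := congrArg Prod.fst hy
    rwa [map_mul φ (_ * y), map_mul φ _ y, Prod.fst_mul, Prod.fst_mul, hφb] at h

/-! ### Varieties not containing the Brandt semigroup -/

lemma exists_le_eq_pow {M : Type*} [Monoid M] {g : M} {k : ℕ} (hk : 2 ≤ k) (hg : g = g ^ k)
    (N : ℕ) : ∃ n, N + 1 ≤ n ∧ g = g ^ n := by
  induction N with
  | zero => exact ⟨k, by omega, hg⟩
  | succ N ih =>
    obtain ⟨n, hn, hgn⟩ := ih
    refine ⟨n - 1 + k, by omega, ?_⟩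
    rw [pow_add, ← hg, ← pow_succ, show n - 1 + 1 = n by omega]
    exact hgn

lemma exists_pow_mul_eq {E : Set SemigroupIdentity} (hE : FinitelyCyclicallyRegular E)
    {S : Type*} [Semigroup S] (hS : MemVariety E S) (P : WithOne S) :
    ∃ d, P ^ 2 = P ^ (2 + (d + 1)) := by
  induction P using WithOne.recOneCoe with
  | one => exact ⟨0, by simp⟩
  | coe s =>
    obtain ⟨d, hd, h⟩ := exists_sq_eq_pow hE hS s
    obtain ⟨d, rfl⟩ := Nat.exists_eq_add_of_le' hd
    exact ⟨d, h⟩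

/-- Periodicity of `p * r` and `s * q` lets either outer factor be cancelled. So `r * b` generates
the same left ideal as `b` and the same right ideal as `g`, and regularity passes from `g` through
`r * b` to `b`. -/
lemma isRegularElement_of_mutual_dvd {E : Set SemigroupIdentity}
    (hE : FinitelyCyclicallyRegular E) {S : Type*} [Semigroup S] (hS : MemVariety E S)
    {b : S} {g h p q r s : WithOne S} (hg : g = g * h * g) (hb : (b : WithOne S) = p * g * q)
    (hgb : g = r * b * s) : IsRegularElement b := by
  have hPQ : (b : WithOne S) = (p * r) * b * (s * q) := by
    conv_lhs => rw [hb, hgb]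
    simp only [mul_assoc]
  have hPQ2 : (b : WithOne S) = (p * r) ^ 2 * b * (s * q) ^ 2 := by
    conv_lhs => rw [hPQ, hPQ]
    simp only [mul_assoc, sq]
  obtain ⟨d, hd⟩ := exists_pow_mul_eq hE hS (p * r)
  obtain ⟨d', hd'⟩ := exists_pow_mul_eq hE hS (s * q)
  have hP : (b : WithOne S) = (p * r) ^ (d + 1) * b := by
    calc (b : WithOne S) = (p * r) ^ 2 * b * (s * q) ^ 2 := hPQ2
      _ = (p * r) ^ (d + 1) * ((p * r) ^ 2 * b * (s * q) ^ 2) := by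
        conv_lhs => rw [hd, add_comm, pow_add]
        simp only [mul_assoc]
      _ = _ := by rw [← hPQ2]
  have hQ : (b : WithOne S) = b * (s * q) ^ (d' + 1) := by
    calc (b : WithOne S) = (p * r) ^ 2 * b * (s * q) ^ 2 := hPQ2
      _ = ((p * r) ^ 2 * b * (s * q) ^ 2) * (s * q) ^ (d' + 1) := by
        conv_lhs => rw [hd', pow_add]
        simp only [mul_assoc]
      _ = _ := by rw [← hPQ2]
  have hc : r * b = g * (q * (s * q) ^ d') := by
    conv_lhs => rw [hQ, pow_succ']
    rw [hgb]; simp only [mul_assoc]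
  have hc' : r * b = r * b * (s * h * r) * b := by
    calc r * b = g * h * (g * (q * (s * q) ^ d')) := by
          rw [hc]; conv_lhs => rw [hg]
          simp only [mul_assoc]
      _ = g * h * (r * b) := by rw [hc]
      _ = _ := by conv_lhs => rw [hgb]
                  simp only [mul_assoc]
  refine isRegularElement_of_coe (z := s * h * r) ?_
  calc (b : WithOne S) = (p * r) ^ d * p * (r * b) := by
        conv_lhs => rw [hP, pow_succ]
        simp only [mul_assoc]
    _ = (p * r) ^ d * p * (r * b * (s * h * r) * b) := by rw [← hc']
    _ = ((p * r) ^ (d + 1) * b) * (s * h * r) * b := by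
        rw [pow_succ]; simp only [mul_assoc]
    _ = _ := by rw [← hP]

/-- With `c = s * g * g * r`, high powers of `g` contain powers of `(a * x) * c`, hence the square
of `a * x`, hence `b`. So `b` and the regular element `g` divide each other. -/
lemma isRegularElement_of_eq_mul_mul {E : Set SemigroupIdentity}
    (hE : FinitelyCyclicallyRegular E) (hB : ¬ MemVariety E Brandt) {S : Type v} [Semigroup S]
    (hS : MemVariety E S) {a x b g : S} (hb : b = a * x * a) {k : ℕ} (hk : 2 ≤ k)
    (hg : (g : WithOne S) = (g : WithOne S) ^ k) {r s : WithOne S}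
    (hrs : (g : WithOne S) * g = r * (a * x) * s) {p q : WithOne S}
    (hpq : (b : WithOne S) = p * g * q) : IsRegularElement b := by
  obtain ⟨m, hm⟩ := exists_pow_eq_mul_sq_mul (E := E) hB
  obtain ⟨c, hc⟩ := exists_coe_eq_mul s r (g * g)
  obtain ⟨p', q', hpq'⟩ := hm S hS (a * x) c
  push_cast at hpq'
  have hpow : ∀ n, r * ((a * x) * c) ^ n * ((a * x) * s) = (g : WithOne S) ^ (4 * n + 2) := by
    intro n
    induction n with
    | zero => simp only [pow_zero, mul_one, mul_zero, zero_add, sq, hrs, mul_assoc]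
    | succ n ih =>
      have h : (g : WithOne S) ^ (4 * (n + 1) + 2) = (g * g) * (g * g) * g ^ (4 * n + 2) := by
        rw [show 4 * (n + 1) + 2 = 1 + 1 + (1 + 1) + (4 * n + 2) by ring]
        simp only [pow_add, pow_one]
      rw [h, ← ih]
      nth_rw 1 [hrs]
      rw [pow_succ', hc]
      push_cast
      simp only [mul_assoc]
  obtain ⟨n, hn, hgn⟩ := exists_le_eq_pow hk hg (4 * m + 2)
  obtain ⟨j, rfl⟩ := Nat.exists_eq_add_of_le hn
  have hgb : (g : WithOne S) = (r * p') * b * (x * q' * (a * x) * s * g ^ (1 + j)) := by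
    conv_lhs => rw [hgn, add_assoc, pow_add, ← hpow, hpq']
    rw [hb]; push_cast
    simp only [mul_assoc]
  obtain ⟨i, hi, hgi⟩ := exists_le_eq_pow hk hg 2
  obtain ⟨i, rfl⟩ := Nat.exists_eq_add_of_le' hi
  refine isRegularElement_of_mutual_dvd hE hS (g := g) (h := g ^ (i + 1)) ?_ hpq hgb
  rw [← pow_succ', ← pow_succ]
  exact hgi

/-! ### Combinatorics of two-letter words -/

lemma exists_true_false_of_cons (s : List Bool) :
    ∃ l₁ l₂, true :: (s ++ [false]) = l₁ ++ [true, false] ++ l₂ := by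
  induction s with
  | nil => exact ⟨[], [], rfl⟩
  | cons t s ih =>
    cases t with
    | false => exact ⟨[], s ++ [false], rfl⟩
    | true =>
      obtain ⟨l₁, l₂, h⟩ := ih
      exact ⟨true :: l₁, l₂, by rw [List.cons_append, h]; rfl⟩

lemma exists_true_false_of_mem {l : List Bool} (ht : true ∈ l) (hf : false ∈ l) :
    ∃ l₁ l₂, l ++ l = l₁ ++ [true, false] ++ l₂ := by
  obtain ⟨s₁, s₂, h⟩ := List.append_of_mem ht
  obtain ⟨s₁', s₂', h'⟩ := List.append_of_mem hf
  obtain ⟨l₁, l₂, hl⟩ := exists_true_false_of_cons (s₂ ++ s₁')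
  refine ⟨s₁ ++ l₁, l₂ ++ s₂', ?_⟩
  calc l ++ l = (s₁ ++ true :: s₂) ++ (s₁' ++ false :: s₂') := by rw [← h, ← h']
    _ = s₁ ++ (true :: (s₂ ++ s₁' ++ [false])) ++ s₂' := by simp
    _ = _ := by rw [hl]; simp

/-- A list of four Boolean letters contains a square of a letter, or is a square. -/
lemma exists_square_of_length_four {w : List Bool} (hw : w.length = 4) :
    (∃ t l₁ l₂, w = l₁ ++ [t, t] ++ l₂) ∨ ∃ t, w = [t, !t] ++ [t, !t] := by
  match w, hw with
  | [p, q, r, s], _ =>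
    by_cases hpq : p = q
    · exact Or.inl ⟨p, [], [r, s], by simp [hpq]⟩
    by_cases hqr : q = r
    · exact Or.inl ⟨q, [p], [s], by simp [hqr]⟩
    by_cases hrs : r = s
    · exact Or.inl ⟨r, [p, q], [], by simp [hrs]⟩
    refine Or.inr ⟨p, ?_⟩
    revert p q r s; decide

/-! ### Shortening the words that divide `a * x * a` -/

section Values

variable {E : Set SemigroupIdentity} {S : Type v} [Semigroup S] {a x b : S}

/-- The value of a list of letters, where `true` stands for `a` and `false` for `x`. -/
def value (a x : S) (l : List Bool) : WithOne S :=
  (l.map fun t => ((if t then a else x : S) : WithOne S)).prod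

lemma value_append (l₁ l₂ : List Bool) : value a x (l₁ ++ l₂) = value a x l₁ * value a x l₂ := by
  simp [value]

lemma exists_coe_eq_value {l : List Bool} (hl : l ≠ []) :
    ∃ s : S, (s : WithOne S) = value a x l := by
  obtain ⟨w, rfl⟩ := exists_letters_eq hl
  exact ⟨_, coe_lift _ w⟩

lemma exists_value_mul_self {l : List Bool} (ht : true ∈ l) (hf : false ∈ l) :
    ∃ r s : WithOne S, value a x l * value a x l = r * (a * x) * s := by
  obtain ⟨l₁, l₂, h⟩ := exists_true_false_of_mem ht hf
  refine ⟨value a x l₁, value a x l₂, ?_⟩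
  rw [← value_append, h, value_append, value_append]
  simp [value]

lemma isRegularElement_of_square (hE : FinitelyCyclicallyRegular E)
    (hB : ¬ MemVariety E Brandt) (hS : MemVariety E S) (hb : b = a * x * a) {l : List Bool}
    (ht : true ∈ l) (hf : false ∈ l) {p q : WithOne S}
    (hpq : (b : WithOne S) = p * value a x (l ++ l) * q) : IsRegularElement b := by
  obtain ⟨s, hs⟩ := exists_coe_eq_value (a := a) (x := x) (List.ne_nil_of_mem ht)
  obtain ⟨r, r', hr⟩ := exists_value_mul_self (a := a) (x := x) ht hf
  obtain ⟨d, hd⟩ := exists_pow_mul_eq hE hS (s : WithOne S)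
  rw [value_append, ← hs] at hpq
  rw [← hs] at hr
  -- Adding the period `d + 1` twice gives `s ^ 2 = s ^ (2 * (d + 2))`.
  refine isRegularElement_of_eq_mul_mul hE hB hS hb (g := s * s) (k := d + 2) (by omega) ?_
    (r := s * r) (s := r' * s) ?_ (p := p) (q := q) (by push_cast; exact hpq)
  · push_cast
    calc (s : WithOne S) * s = s ^ 2 := (sq _).symm
      _ = s ^ (2 + (d + 1)) := hd
      _ = s ^ 2 * s ^ (d + 1) := pow_add _ _ _
      _ = s ^ (2 + (d + 1)) * s ^ (d + 1) := by rw [← hd]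
      _ = (s * s) ^ (d + 2) := by rw [← pow_add, ← sq, ← pow_mul]; congr 1; omega
  · push_cast
    calc (s : WithOne S) * s * (s * s) = s * (s * s) * s := by simp only [mul_assoc]
      _ = _ := by rw [hr]; simp only [mul_assoc]

/-- An idempotent power of the letter `t` fixes its square, so it is a two-sided identity for the
value `z` of the middle word, and `exists_eq_pow_of_idempotent` supplies `z = z ^ k`. -/
lemma isRegularElement_of_separated_squares (hE : FinitelyCyclicallyRegular E)
    (hB : ¬ MemVariety E Brandt) (hS : MemVariety E S) (hb : b = a * x * a) {t : Bool}
    {l : List Bool} (hl : (!t) ∈ l) {p q : WithOne S}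
    (hpq : (b : WithOne S) = p * value a x ([t, t] ++ l ++ [t, t]) * q) :
    IsRegularElement b := by
  have hmem : ∀ i : Bool, i ∈ [t, t] ++ l ++ [t, t] := by
    intro i
    by_cases hi : i = t
    · simp [hi]
    · have : i = !t := Bool.eq_not_of_ne hi
      simp [this, hl]
  obtain ⟨z, hz⟩ := exists_coe_eq_value (a := a) (x := x) (List.ne_nil_of_mem (hmem true))
  obtain ⟨r, r', hr⟩ := exists_value_mul_self (a := a) (x := x) (hmem true) (hmem false)
  rw [← hz] at hpq hr
  let s : S := if t then a else x
  obtain ⟨d, hd⟩ := exists_pow_mul_eq hE hS (s : WithOne S)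
  have hd₂ : (s : WithOne S) ^ 2 * s ^ (2 * (d + 1)) = s ^ 2 := by
    rw [two_mul, pow_add, ← mul_assoc, ← pow_add, ← hd, ← pow_add, ← hd]
  have hd₂' : (s : WithOne S) ^ (2 * (d + 1)) * s ^ 2 = s ^ 2 := by
    rw [← pow_add, add_comm, pow_add, hd₂]
  -- The period is doubled so that the exponent is at least 2, where periodicity begins.
  obtain ⟨e, he⟩ := exists_coe_eq_pow s (n := 2 * (d + 1)) (by omega)
  have hzs : (z : WithOne S) = s ^ 2 * value a x l * s ^ 2 := by
    rw [hz, value_append, value_append]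
    simp [value, s, sq]
  obtain ⟨k, hk, hzk⟩ := exists_eq_pow_of_idempotent hE hS (e := e) (z := z)
    (by
      apply WithOne.coe_injective
      push_cast
      rw [he]
      nth_rw 1 [show 2 * (d + 1) = 2 * d + 2 by ring]
      rw [pow_add, mul_assoc, hd₂, ← pow_add]
      rfl)
    (by
      apply WithOne.coe_injective
      push_cast
      rw [he, hzs, ← mul_assoc, ← mul_assoc, hd₂'])
    (by
      apply WithOne.coe_injective
      push_cast
      rw [he, hzs, mul_assoc, hd₂])
  exact isRegularElement_of_eq_mul_mul hE hB hS hb hk hzk hr hpq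

/-- If `a * x * a` is not regular, then a divisor of `a * x * a` represented by a long word is
represented by a shorter one. -/
lemma exists_shorter (hE : FinitelyCyclicallyRegular E) (hB : ¬ MemVariety E Brandt)
    (hS : MemVariety E S) (hb : b = a * x * a) (hreg : ¬ IsRegularElement b) :
    ∃ N, ∀ l : List Bool, N ≤ l.length →
      (∃ p q : WithOne S, (b : WithOne S) = p * value a x l * q) →
      ∃ l' : List Bool, l'.length < l.length ∧ value a x l' = value a x l := by
  obtain ⟨K, hK⟩ : ∃ K, ∀ t, ∃ k < K, value a x (List.replicate k t) =
      value a x (List.replicate K t) := by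
    have hrep : ∀ n t, value a x (List.replicate n t) =
        ((if t then a else x : S) : WithOne S) ^ n := fun n t => by simp [value]
    choose d hd using fun t : Bool =>
      exists_pow_mul_eq hE hS ((if t then a else x : S) : WithOne S)
    -- For either letter, removing its own period leaves an exponent of at least 2.
    refine ⟨2 + (d true + 1) + (d false + 1), fun t => ?_⟩
    rw [hrep]
    cases t with
    | true =>
      refine ⟨2 + (d false + 1), by omega, ?_⟩
      rw [hrep, pow_add, hd true, ← pow_add]
    | false =>
      refine ⟨2 + (d true + 1), by omega, ?_⟩
      rw [hrep, pow_add, hd false, ← pow_add]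
      congr 1; omega
  -- Each of three blocks of length 4 must contain a repeated letter, and each gap of length `K`
  -- both letters. Two of the three repeated letters agree, which gives separated squares.
  refine ⟨4 + K + 4 + K + 4, fun l hl ⟨p, q, hpq⟩ => ?_⟩
  by_contra! hmin
  have hrun : ∀ t l₁ l₂, l ≠ l₁ ++ List.replicate K t ++ l₂ := by
    rintro t l₁ l₂ rfl
    obtain ⟨k, hk, hkK⟩ := hK t
    refine hmin (l₁ ++ List.replicate k t ++ l₂) (by simp; omega) ?_
    simp only [value_append, hkK]
  have hsq : ∀ u l₁ l₂, true ∈ u → false ∈ u → l ≠ l₁ ++ (u ++ u) ++ l₂ := by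
    rintro u l₁ l₂ ht hf rfl
    refine hreg (isRegularElement_of_square hE hB hS hb ht hf
      (p := p * value a x l₁) (q := value a x l₂ * q) ?_)
    rw [hpq, value_append, value_append]
    simp only [mul_assoc]
  have hsep : ∀ t y l₁ l₂, (!t) ∈ y → l ≠ l₁ ++ ([t, t] ++ y ++ [t, t]) ++ l₂ := by
    rintro t y l₁ l₂ hy rfl
    refine hreg (isRegularElement_of_separated_squares hE hB hS hb hy
      (p := p * value a x l₁) (q := value a x l₂ * q) ?_)
    rw [hpq, value_append, value_append]
    simp only [mul_assoc]
  have hfour : ∀ w l₁ l₂, w.length = 4 → l = l₁ ++ w ++ l₂ →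
      ∃ t w₁ w₂, w = w₁ ++ [t, t] ++ w₂ := by
    intro w l₁ l₂ hw h
    rcases exists_square_of_length_four hw with h' | ⟨t, rfl⟩
    · exact h'
    · exact absurd h (hsq [t, !t] l₁ l₂ (by cases t <;> simp) (by cases t <;> simp))
  have hgap : ∀ g l₁ l₂, g.length = K → l = l₁ ++ g ++ l₂ → ∀ t, t ∈ g := by
    intro g l₁ l₂ hg h t
    by_contra ht
    refine hrun (!t) l₁ l₂ ?_
    rw [h, List.eq_replicate_iff.2 ⟨hg, fun s hs => ?_⟩]
    exact Bool.eq_not_of_ne fun hst => ht (hst ▸ hs)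
  have hsplit : ∀ (n : ℕ) (m : List Bool), n ≤ m.length →
      ∃ m₁ m₂, m = m₁ ++ m₂ ∧ m₁.length = n := fun n m hn =>
    ⟨m.take n, m.drop n, (List.take_append_drop n m).symm, by simp [hn]⟩
  obtain ⟨w₁, r₁, h₁, hw₁⟩ := hsplit 4 l (by omega)
  have hr₁ : w₁.length + r₁.length = l.length := by rw [h₁, List.length_append]
  obtain ⟨g₁, r₂, h₂, hg₁⟩ := hsplit K r₁ (by omega)
  have hr₂ : g₁.length + r₂.length = r₁.length := by rw [h₂, List.length_append]
  obtain ⟨w₂, r₃, h₃, hw₂⟩ := hsplit 4 r₂ (by omega)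
  have hr₃ : w₂.length + r₃.length = r₂.length := by rw [h₃, List.length_append]
  obtain ⟨g₂, r₄, h₄, hg₂⟩ := hsplit K r₃ (by omega)
  have hr₄ : g₂.length + r₄.length = r₃.length := by rw [h₄, List.length_append]
  obtain ⟨w₃, r₅, h₅, hw₃⟩ := hsplit 4 r₄ (by omega)
  subst h₅ h₄ h₃ h₂
  obtain ⟨t₁, u₁, v₁, rfl⟩ := hfour w₁ [] _ hw₁ (by rw [h₁]; simp; rfl)
  obtain ⟨t₂, u₂, v₂, rfl⟩ := hfour w₂ (u₁ ++ [t₁, t₁] ++ v₁ ++ g₁) (g₂ ++ (w₃ ++ r₅)) hw₂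
    (by rw [h₁]; simp)
  obtain ⟨t₃, u₃, v₃, rfl⟩ := hfour w₃
    (u₁ ++ [t₁, t₁] ++ v₁ ++ g₁ ++ (u₂ ++ [t₂, t₂] ++ v₂) ++ g₂) r₅ hw₃
    (by rw [h₁]; simp)
  have hG₁ := hgap g₁ (u₁ ++ [t₁, t₁] ++ v₁)
    ((u₂ ++ [t₂, t₂] ++ v₂) ++ g₂ ++ (u₃ ++ [t₃, t₃] ++ v₃) ++ r₅) hg₁ (by rw [h₁]; simp)
  have hG₂ := hgap g₂ (u₁ ++ [t₁, t₁] ++ v₁ ++ g₁ ++ (u₂ ++ [t₂, t₂] ++ v₂))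
    ((u₃ ++ [t₃, t₃] ++ v₃) ++ r₅) hg₂ (by rw [h₁]; simp)
  by_cases h₁₂ : t₁ = t₂
  · subst h₁₂
    exact hsep t₁ (v₁ ++ g₁ ++ u₂) u₁ (v₂ ++ g₂ ++ (u₃ ++ [t₃, t₃] ++ v₃) ++ r₅)
      (by simp [hG₁]) (by rw [h₁]; simp)
  by_cases h₂₃ : t₂ = t₃
  · subst h₂₃
    exact hsep t₂ (v₂ ++ g₂ ++ u₃) (u₁ ++ [t₁, t₁] ++ v₁ ++ g₁ ++ u₂) (v₃ ++ r₅)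
      (by simp [hG₂]) (by rw [h₁]; simp)
  obtain rfl : t₁ = t₃ := by
    clear * - h₁₂ h₂₃
    revert t₁ t₂ t₃; decide
  exact hsep t₁ (v₁ ++ g₁ ++ (u₂ ++ [t₂, t₂] ++ v₂) ++ g₂ ++ u₃) u₁ (v₃ ++ r₅)
    (by simp [hG₁]) (by rw [h₁]; simp)

lemma isRegularElement_of_brandt_not_mem (hE : FinitelyCyclicallyRegular E)
    (hB : ¬ MemVariety E Brandt) (hS : MemVariety E S) (a x : S) :
    IsRegularElement (a * x * a) := by
  by_contra hreg
  obtain ⟨N, hN⟩ := exists_shorter hE hB hS rfl hreg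
  have hshort : ∀ n, ∀ l : List Bool, l.length = n →
      (∃ p q : WithOne S, ((a * x * a : S) : WithOne S) = p * value a x l * q) →
      ∃ l' : List Bool, l'.length < N ∧ value a x l' = value a x l := by
    intro n
    induction n using Nat.strong_induction_on with
    | _ n ih =>
      intro l hl hdvd
      by_cases hlN : N ≤ l.length
      · obtain ⟨l', hl', hv⟩ := hN l hlN hdvd
        obtain ⟨l'', hl'', hv'⟩ := ih _ (hl ▸ hl') l' rfl (by rwa [hv])
        exact ⟨l'', hl'', hv'.trans hv⟩
      · exact ⟨l, by omega, rfl⟩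
  let φ : FreeSemigroup Bool →ₙ* S := FreeSemigroup.lift fun t => if t then a else x
  have hφ : ∀ w, (φ w : WithOne S) = value a x (letters w) := coe_lift _
  let ta := FreeSemigroup.of true
  let tx := FreeSemigroup.of false
  have hφb : φ (ta * tx * ta) = a * x * a := rfl
  -- The ideal consists of the words whose values do not divide `a * x * a`; by `hshort` all other
  -- values come from words shorter than `N`.
  obtain ⟨y, hy⟩ := exists_regular_preimage hE hS φ
    {w | ∀ p q : WithOne S, ((a * x * a : S) : WithOne S) ≠ p * φ w * q}
    (fun w hw v => by
      refine ⟨fun p q h => hw p (φ v * q) ?_, fun p q h => hw (p * φ v) q ?_⟩ <;>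
      · rw [h, map_mul, WithOne.coe_mul]
        simp only [mul_assoc])
    (by
      refine Set.Finite.of_finite_image (f := ((↑) : S → WithOne S))
        (((List.finite_length_lt Bool N).image (value a x)).subset ?_)
        WithOne.coe_injective.injOn
      rintro _ ⟨_, ⟨w, hw, rfl⟩, rfl⟩
      simp only [Set.mem_compl_iff, Set.mem_ofPred_eq, not_forall, not_not] at hw
      obtain ⟨l', hl', hv⟩ := hshort _ (letters w) rfl (by rwa [← hφ])
      exact ⟨l', hl', by rw [hv, hφ]⟩)
    (b := ta * tx * ta) ⟨ta, Or.inr ⟨tx, rfl⟩⟩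
    (fun w hw h => hw 1 1 (by rw [h, hφb]; simp))
  exact hreg ⟨φ y, by rw [← hφb, ← map_mul, ← map_mul]; exact hy⟩

end Values

lemma isCyclicallyRegular_of_memVariety {E : Set SemigroupIdentity}
    (hE : FinitelyCyclicallyRegular E) {S : Type*} [Semigroup S] (hS : MemVariety E S) :
    IsCyclicallyRegular S := by
  rintro _ ⟨a, rfl | ⟨x, rfl⟩⟩
  · obtain ⟨d, hd⟩ := exists_pow_mul_eq hE hS (a : WithOne S)
    -- Two periods add `2 * d + 2` to the exponent, enough for a second factor `a * a`.
    refine isRegularElement_of_coe (z := (a : WithOne S) ^ (2 * d)) ?_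
    push_cast
    calc (a : WithOne S) * a = a ^ 2 := (sq _).symm
      _ = a ^ (2 + (d + 1)) := hd
      _ = a ^ 2 * a ^ (d + 1) := pow_add _ _ _
      _ = a ^ (2 + (d + 1)) * a ^ (d + 1) := by rw [← hd]
      _ = a ^ 2 * a ^ (2 * d) * a ^ 2 := by
        rw [← pow_add, ← pow_add, ← pow_add]; congr 1; omega
      _ = _ := by rw [sq]
  · by_cases hB : MemVariety E Brandt
    · exact isRegularElement_of_brandt_mem hE hB hS a x
    · exact isRegularElement_of_brandt_not_mem hE hB hS a x

end SemigroupIdentity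

theorem corollary2 (E : Set SemigroupIdentity)
    (hfin : ∀ (F : Type*) [Semigroup F] [Finite F], MemVariety E F → IsCyclicallyRegular F) :
    ∀ (S : Type*) [Semigroup S], MemVariety E S → IsCyclicallyRegular S := by
  intro S _ hS
  exact SemigroupIdentity.isCyclicallyRegular_of_memVariety
    (SemigroupIdentity.finitelyCyclicallyRegular_of_universe hfin) hS
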